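/- A server holds $N\ge 1$ independent files, each uniformly distributed over $\{1,\dots,2^F\}$. It is connected by a noiseless shared link to $K_1$ relays, and relay $i$ is connected by a noiseless shared link to its own $K_2\ge 1$ users. Every relay has a cache of $M_1F$ bits and every user a cache of $M_2F$ bits, $M_1,M_2\in[0,N]$, filled as functions of the library before the requests are known. Then each user requests one file, and the requests become known to all. In each transmission slot the server sends one bit to all the relays and, simultaneously, each relay sends one bit to all its users; the relay's bit is a function of its cache, the requests and the server's bits of the earlier slots. After the last slot each user decodes its file from its relay's bits, its cache and the requests. The coding delay is the number of slots divided by $F$. A delay $T$ is achievable if for every $\epsilon>0$ and every large enough $F$ there is such a scheme whose error probability is less than $\epsilon$ for every user and every request vector and whose coding delay is at most $T$ for every request vector; $T^*$ is the infimum of the achievable delays. For $x\in(0,1]$ let $$r(x,K)=\Big[K(1-x)\,\frac{1}{Kx}\,\big(1-(1-x)^K\big)\Big]^+,\qquad r(0,K)=K .$$ For two relays ($K_1=2$), $$T^*\le r\Big(\frac{M_2}{N},K_2\Big)\quad\text{if}\quad \frac{M_1}{N}\ge\Big(1-\frac{M_1}{N}\Big)^2\Big(1-\frac{M_2}{N}\Big)^{K_2},$$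 and otherwise $$T^*\le \frac{M_1}{N}\Big(1-\frac{M_1}{N}\Big)\,r\Big(\frac{M_2}{N},K_2\Big)+\Big(1-\frac{M_1}{N}\Big)^2\,r\Big(\frac{M_2}{N},2K_2\Big).$$ -/

import Mathlib

namespace TwoLayerCaching

/-- The library `(W_1, …, W_N)`: `N` files, each taking one of `2 ^ F` values (`F` bits). -/
abbrev Library (N F : ℕ) : Type := Fin N → Fin (2 ^ F)

/-- A request vector: `d i j` is the index of the file that the `j`-th user of relay `i` wants. -/
abbrev Demand (N K₁ K₂ : ℕ) : Type := Fin K₁ → Fin K₂ → Fin N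

/-- The contents of a cache memory of `M * F` bits. -/
abbrev Cache (F : ℕ) (M : ℝ) : Type := Fin ⌊(2 : ℝ) ^ ((F : ℝ) * M)⌋₊

/-- A caching scheme, with its delivery phase resolved into transmission slots.
For the request vector `d` the delivery takes `slots d` slots. In every slot the server
puts one bit on the link that it shares with all relays and, at the same time, every relay puts
one bit on the link that it shares with its own users. A relay knows its cache content, the
request vector and the bits that the server sent in earlier slots. -/
structure CachingScheme (N K₁ K₂ F : ℕ) (M₁ M₂ : ℝ) where
  /-- caching functions of the relays -/
  relayCache : Fin K₁ → Library N F → Cache F M₁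
  /-- caching functions of the users -/
  userCache : Fin K₁ → Fin K₂ → Library N F → Cache F M₂
  /-- number of transmission slots -/
  slots : Demand N K₁ K₂ → ℕ
  /-- encoding function of the server -/
  serverEncode : (d : Demand N K₁ K₂) → Library N F → (Fin (slots d) → Bool)
  /-- encoding functions of the relays -/
  relayEncode : (d : Demand N K₁ K₂) → Fin K₁ → Cache F M₁ → (Fin (slots d) → Bool) →
    (Fin (slots d) → Bool)
  /-- a relay's bit in slot `t` depends only on the server bits of the slots before `t` -/
  relay_causal : ∀ (d : Demand N K₁ K₂) (i : Fin K₁) (z : Cache F M₁)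
    (x x' : Fin (slots d) → Bool) (t : Fin (slots d)),
    (∀ s, s < t → x s = x' s) → relayEncode d i z x t = relayEncode d i z x' t
  /-- decoding functions of the users -/
  decode : (d : Demand N K₁ K₂) → Fin K₁ → Fin K₂ → (Fin (slots d) → Bool) → Cache F M₂ →
    Fin (2 ^ F)

namespace CachingScheme

variable {N K₁ K₂ F : ℕ} {M₁ M₂ : ℝ} (S : CachingScheme N K₁ K₂ F M₁ M₂)

/-- The file that user `(i, j)` reconstructs, when the library is `W` and the requests are `d`. -/
def output (d : Demand N K₁ K₂) (i : Fin K₁) (j : Fin K₂) (W : Library N F) : Fin (2 ^ F) :=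
  S.decode d i j (S.relayEncode d i (S.relayCache i W) (S.serverEncode d W)) (S.userCache i j W)

/-- The probability that user `(i, j)` fails to recover its requested file, the files being
independent and uniformly distributed. -/
noncomputable def errorProb (d : Demand N K₁ K₂) (i : Fin K₁) (j : Fin K₂) : NNReal :=
  ((Finset.univ.filter fun W : Library N F => S.output d i j W ≠ W (d i j)).card : NNReal) /
    (Fintype.card (Library N F) : NNReal)

/-- The worst-case probability of error, over all request vectors and all users. -/
noncomputable def worstErrorProb : NNReal :=
  Finset.univ.sup fun x : Demand N K₁ K₂ × Fin K₁ × Fin K₂ => S.errorProb x.1 x.2.1 x.2.2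

/-- The coding delay for the request vector `d`: the slots normalized to the file size. -/
noncomputable def codingDelay (d : Demand N K₁ K₂) : ℝ := (S.slots d : ℝ) / (F : ℝ)

end CachingScheme

/-- The worst-case coding delay `T` is achievable: for every `ε > 0` and all large enough file
sizes there is a caching scheme with error probability below `ε` and with delay at most `T` for
every request vector. -/
def IsAchievableDelay (N K₁ K₂ : ℕ) (M₁ M₂ T : ℝ) : Prop :=
  ∀ ε : NNReal, 0 < ε → ∀ᶠ F : ℕ in Filter.atTop,
    ∃ S : CachingScheme N K₁ K₂ F M₁ M₂, S.worstErrorProb < ε ∧ ∀ d, S.codingDelay d ≤ T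

/-- The optimal coding delay `T*`. As an infimum in the extended reals it would be `⊤` if no
delay were achievable. -/
noncomputable def optimalDelay (N K₁ K₂ : ℕ) (M₁ M₂ : ℝ) : EReal :=
  sInf ((fun T : ℝ => (T : EReal)) '' {T : ℝ | IsAchievableDelay N K₁ K₂ M₁ M₂ T})

/-- The delay `r(x, K)` of the single-layer decentralized scheme with `K` users that cache a
fraction `x` of the library; at `x = 0` it is `K`, the limit of the formula. -/
noncomputable def r (x : ℝ) (K : ℕ) : ℝ :=
  if x = 0 then (K : ℝ)
  else max ((K : ℝ) * (1 - x) * (1 / ((K : ℝ) * x)) * (1 - (1 - x) ^ K)) 0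

end TwoLayerCaching

/-!
Write `p = M₁ / N` and `q = M₂ / N`. Cut every file into pieces indexed by a set `A` of relays and
a set `B` of users, of relative size `p ^ |A| (1 - p) ^ (2 - |A|) q ^ |B| (1 - q) ^ (2 K₂ - |B|)`, and
let exactly the relays in `A` and the users in `B` cache the piece. These are the typical sizes that
a random placement would produce; choosing them deterministically, up to rounding, makes the scheme
free of errors.

For a set `S` of users and a set `A` of relays, let `m i A S` be the sum modulo 2 of the pieces
`(A, S \ {u})` requested by the users `u ∈ S` of relay `i` (`codedBit`). Each such `u` knows all
summands but its own. Relay `i` has to transmit `m i A S` for every `A` and every `S` that meets its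
group, which takes the delay `r q K₂` (`sum_weight_pred`, `r_eq_geom_sum`). If `i ∈ A`, the relay
finds this message in its cache. If only the other relay has cached the pieces, the server sends the
sum of the messages that the two relays need from each other's caches; each relay removes the term
that it knows. This costs the server `p (1 - p) r q K₂`. If `A` is empty, the server sends
`m 0 ∅ S + m 1 ∅ S`, which also serves the users as it is; this costs `(1 - p) ^ 2 r q (2 K₂)`, and
each relay forwards only the messages for the sets that meet its group.

A relay forwards every useful server bit one slot after it was sent, and sends its own messages in
the idle slots (`exists_scheme`). Hence the delay is the maximum of the server delay and the relay
delay, up to a term that vanishes as `F → ∞` (`isAchievableDelay_two_relays`). Since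
`r q (2 K₂) = (1 + (1 - q) ^ K₂) r q K₂` (`r_two_mul`), the condition of the theorem decides which
of the two is larger (`server_delay_eq`).
-/

namespace TwoLayerCaching

/-! ### Pipelined transmission -/

/-- A schedule `pos` of the messages `Q` can be followed by somebody who repeats the messages in `U`
at the times prescribed by `pos` and puts the further messages in `O` into the idle slots. -/
theorem exists_schedule {Q U O : Type*} [Fintype U] [Fintype O] {n : ℕ}
    (pos : Q ↪ Fin n) (f : U ↪ Q) (h : Fintype.card U + Fintype.card O ≤ n) :
    ∃ τ : U ⊕ O ↪ Fin n, ∀ u, τ (Sum.inl u) = pos (f u) := by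
  classical
  let s : Finset (Fin n) := (Finset.univ.map (f.trans pos))ᶜ
  have hs : Fintype.card O ≤ Fintype.card s := by
    rw [Fintype.card_coe, Finset.card_compl, Finset.card_map, Finset.card_univ, Fintype.card_fin]
    omega
  obtain ⟨g⟩ := Function.Embedding.nonempty_of_card_le hs
  refine ⟨⟨Sum.elim (fun u => pos (f u)) (fun o => (g o : Fin n)), ?_⟩, fun u => rfl⟩
  refine Function.Injective.sumElim (f.trans pos).injective
    (Subtype.val_injective.comp g.injective) fun u o he => ?_
  have hg := (g o).2
  rw [Finset.mem_compl] at hg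
  exact hg (Finset.mem_map.2 ⟨u, Finset.mem_univ u, he⟩)

/-- Pipelining. Suppose that the server's messages `Q` fit into `n` slots, and that the messages of
each relay, namely the forwarded ones in `U i` and the ones in `O i` computed from its cache alone,
also fit into `n` slots. Then `n + 1` slots suffice for an error-free scheme: the relay repeats a
server bit one slot after it was sent, after undoing the interference with the help of its cache.
The hypothesis `hdec` says that the relay's messages and the user's cache determine the file. -/
theorem exists_scheme {N K₁ K₂ F n : ℕ} {M₁ M₂ : ℝ} {Q : Type*} {U O : Fin K₁ → Type*}
    [Fintype Q] [∀ i, Fintype (U i)] [∀ i, Fintype (O i)]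
    (relayCache : Fin K₁ → Library N F → Cache F M₁)
    (userCache : Fin K₁ → Fin K₂ → Library N F → Cache F M₂)
    (f : ∀ i, U i ↪ Q) (hQ : Fintype.card Q ≤ n)
    (hR : ∀ i, Fintype.card (U i) + Fintype.card (O i) ≤ n)
    (server : Demand N K₁ K₂ → Library N F → Q → Bool)
    (forward : Demand N K₁ K₂ → ∀ i, U i → Cache F M₁ → Bool → Bool)
    (own : Demand N K₁ K₂ → ∀ i, O i → Cache F M₁ → Bool)
    (hdec : ∀ d i j W W', userCache i j W = userCache i j W' →
      (∀ u, forward d i u (relayCache i W) (server d W (f i u)) =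
        forward d i u (relayCache i W') (server d W' (f i u))) →
      (∀ o, own d i o (relayCache i W) = own d i o (relayCache i W')) → W (d i j) = W' (d i j)) :
    ∃ S : CachingScheme N K₁ K₂ F M₁ M₂,
      (∀ d, S.slots d = n + 1) ∧ ∀ d i j W, S.output d i j W = W (d i j) := by
  classical
  obtain ⟨pos⟩ : Nonempty (Q ↪ Fin n) :=
    Function.Embedding.nonempty_of_card_le (by simpa using hQ)
  choose τ hτ using fun i => exists_schedule (O := O i) pos (f i) (hR i)
  -- the last server slot is idle, and so is the first slot of every relay
  let enc : (d : Demand N K₁ K₂) → Library N F → Fin (n + 1) → Bool := fun d W =>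
    Function.extend (fun q => (pos q).castSucc) (server d W) fun _ => false
  let msg : (d : Demand N K₁ K₂) → (i : Fin K₁) → Cache F M₁ → (Fin (n + 1) → Bool) →
      U i ⊕ O i → Bool := fun d i z x =>
    Sum.elim (fun u => forward d i u z (x (pos (f i u)).castSucc)) (fun o => own d i o z)
  let rel : (d : Demand N K₁ K₂) → (i : Fin K₁) → Cache F M₁ → (Fin (n + 1) → Bool) →
      Fin (n + 1) → Bool := fun d i z x =>
    Fin.cons false (Function.extend (τ i) (msg d i z x) fun _ => false)
  have henc : ∀ d W q, enc d W (pos q).castSucc = server d W q := fun d W q =>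
    Function.Injective.extend_apply
      ((Fin.castSucc_injective n).comp pos.injective) (server d W) _ q
  have hrel : ∀ d i z x m, rel d i z x (τ i m).succ = msg d i z x m := fun d i z x m => by
    simp only [rel, Fin.cons_succ]
    exact (τ i).injective.extend_apply _ _ m
  have hfac : ∀ d i j, Function.FactorsThrough (fun W : Library N F => W (d i j))
      (fun W => (rel d i (relayCache i W) (enc d W), userCache i j W)) := by
    intro d i j W W' h
    have h₁ : rel d i (relayCache i W) (enc d W) = rel d i (relayCache i W') (enc d W') :=
      congrArg Prod.fst h
    have h₂ : userCache i j W = userCache i j W' := congrArg Prod.snd h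
    have hm : ∀ m, msg d i (relayCache i W) (enc d W) m =
        msg d i (relayCache i W') (enc d W') m := fun m => by
      rw [← hrel, ← hrel]
      exact congrFun h₁ _
    refine hdec d i j W W' h₂ (fun u => ?_) fun o => hm (Sum.inr o)
    have := hm (Sum.inl u)
    simpa only [msg, Sum.elim_inl, henc] using this
  refine ⟨{ relayCache := relayCache
            userCache := userCache
            slots := fun _ => n + 1
            serverEncode := enc
            relayEncode := rel
            relay_causal := ?_
            decode := fun d i j y z => Function.extend
              (fun W => (rel d i (relayCache i W) (enc d W), userCache i j W))
              (fun W : Library N F => W (d i j)) (fun _ => ⟨0, by positivity⟩) (y, z) },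
    fun _ => rfl, fun d i j W => ?_⟩
  swap
  · exact (hfac d i j).extend_apply (fun _ => ⟨0, by positivity⟩) W
  intro d i z x x' t hx
  refine Fin.cases (fun _ => rfl) (fun t hx => ?_) t hx
  simp only [rel, Fin.cons_succ]
  by_cases ht : ∃ m, τ i m = t
  · obtain ⟨m, rfl⟩ := ht
    rw [(τ i).injective.extend_apply, (τ i).injective.extend_apply]
    cases m with
    | inl u =>
      have : x (pos (f i u)).castSucc = x' (pos (f i u)).castSucc :=
        hx _ (by rw [hτ]; exact Fin.castSucc_lt_succ)
      simp only [msg, Sum.elim_inl, this]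
    | inr o => rfl
  · rw [Function.extend_apply' _ _ _ ht, Function.extend_apply' _ _ _ ht]

/-! ### Cutting files into pieces -/

/-- A file of `F` bits can be cut into pieces whose sizes are `F * w a` up to a bounded error. Only
the piece `a₀` may be larger than `F * w a`; it absorbs all the rounding. -/
theorem exists_rounding {P : Type*} [Fintype P] [DecidableEq P] (a₀ : P) (w : P → ℝ)
    (hw : ∀ a, 0 ≤ w a) (hsum : ∑ a, w a = 1) (F : ℕ) :
    ∃ size : P → ℕ, ∑ a, size a = F ∧ (∀ a, a ≠ a₀ → (size a : ℝ) ≤ F * w a) ∧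
      ∀ a, (size a : ℝ) ≤ F * w a + Fintype.card P := by
  have hF : ∑ a, (F : ℝ) * w a = F := by rw [← Finset.mul_sum, hsum, mul_one]
  have hfl : ∀ a, (⌊(F : ℝ) * w a⌋₊ : ℝ) ≤ F * w a := fun a =>
    Nat.floor_le (mul_nonneg F.cast_nonneg (hw a))
  have hle : ∑ a, ⌊(F : ℝ) * w a⌋₊ ≤ F := by
    have : ((∑ a, ⌊(F : ℝ) * w a⌋₊ : ℕ) : ℝ) ≤ F := by
      rw [Nat.cast_sum]
      exact (Finset.sum_le_sum fun a _ => hfl a).trans hF.le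
    exact_mod_cast this
  have hge : (F : ℝ) ≤ ((∑ a, ⌊(F : ℝ) * w a⌋₊ : ℕ) : ℝ) + Fintype.card P := by
    have : ∑ a, (F : ℝ) * w a ≤ ∑ a, ((⌊(F : ℝ) * w a⌋₊ : ℝ) + 1) :=
      Finset.sum_le_sum fun a _ => (Nat.lt_floor_add_one _).le
    rw [hF, Finset.sum_add_distrib] at this
    simpa using this
  refine ⟨fun a => ⌊(F : ℝ) * w a⌋₊ + if a = a₀ then F - ∑ b, ⌊(F : ℝ) * w b⌋₊ else 0,
    ?_, fun a ha => ?_, fun a => ?_⟩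
  · rw [Finset.sum_add_distrib, Finset.sum_ite_eq' Finset.univ a₀]
    simp only [Finset.mem_univ, if_true]
    omega
  · simpa [ha] using hfl a
  · have h := hfl a
    dsimp only
    split_ifs with hc
    · push_cast [Nat.cast_sub hle]
      push_cast at hge
      linarith
    · push_cast
      have : (0 : ℝ) ≤ Fintype.card P := Nat.cast_nonneg _
      linarith

/-! ### Storing pieces in caches -/

/-- The bit number `k` of the piece `a` of file `n`, where `e` identifies a file with its bits
arranged in pieces. Pieces are padded by zeros (`false`), so that pieces of different sizes can be
added bit by bit. -/
def pieceBit {P : Type*} {N F : ℕ} {size : P → ℕ}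
    (e : Fin (2 ^ F) ≃ ((Σ a, Fin (size a)) → Bool)) (W : Library N F) (n : Fin N) (a : P)
    (k : ℕ) : Bool :=
  if h : k < size a then e (W n) ⟨a, k, h⟩ else false

/-- A cache that is large enough for the pieces satisfying `c` of all files can store and return
them exactly. -/
theorem exists_cache {P : Type*} [Fintype P] {N F : ℕ} {M : ℝ} {size : P → ℕ}
    (e : Fin (2 ^ F) ≃ ((Σ a, Fin (size a)) → Bool)) (c : P → Prop) [DecidablePred c]
    (h : (N * ∑ a with c a, size a : ℝ) ≤ F * M) :
    ∃ (store : Library N F → Cache F M) (read : Cache F M → Fin N → P → ℕ → Bool),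
      ∀ W n a k, c a → read (store W) n a k = pieceBit e W n a k := by
  classical
  let X := Fin N × Σ a : {a // c a}, Fin (size a)
  have hcard : Fintype.card (X → Bool) ≤ Fintype.card (Cache F M) := by
    have hX : (Fintype.card X : ℝ) ≤ F * M := by
      refine le_trans (le_of_eq ?_) h
      rw [Fintype.card_prod, Fintype.card_sigma]
      simp only [Fintype.card_fin]
      rw [← Finset.sum_subtype_eq_sum_filter]
      simp [Finset.subtype_univ]
    rw [Fintype.card_fun, Fintype.card_bool, Fintype.card_fin]
    refine Nat.le_floor ?_
    rw [Nat.cast_pow, ← Real.rpow_natCast]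
    exact Real.rpow_le_rpow_of_exponent_le (by norm_num) hX
  obtain ⟨g⟩ := Function.Embedding.nonempty_of_card_le hcard
  refine ⟨fun W => g fun x => e (W x.1) ⟨x.2.1, x.2.2⟩, fun z n a k =>
    if ha : c a then if hk : k < size a then
      Function.invFun g z (n, ⟨⟨a, ha⟩, ⟨k, hk⟩⟩) else false else false, fun W n a k ha => ?_⟩
  dsimp only
  rw [dif_pos ha, Function.leftInverse_invFun g.injective]
  rfl

/-! ### Piece sizes and the delay of the single-layer scheme -/

/-- The probability that a random subset of an `n`-element set, containing each point
independently with probability `x`, equals a given subset of cardinality `k`. -/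
def weight (n : ℕ) (x : ℝ) (k : ℕ) : ℝ := x ^ k * (1 - x) ^ (n - k)

theorem weight_nonneg {x : ℝ} (hx : x ∈ Set.Icc (0 : ℝ) 1) (n k : ℕ) : 0 ≤ weight n x k :=
  mul_nonneg (pow_nonneg hx.1 _) (pow_nonneg (sub_nonneg.2 hx.2) _)

section
variable {V : Type*} [Fintype V] [DecidableEq V]

/-- The probability that a random subset avoids `D`. -/
theorem sum_weight_disjoint (x : ℝ) (D : Finset V) :
    ∑ S : Finset V with Disjoint S D, weight (Fintype.card V) x S.card = (1 - x) ^ D.card := by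
  have hs : (Finset.univ.filter fun S : Finset V => Disjoint S D) = Dᶜ.powerset := by
    ext S
    simp [Finset.mem_powerset, Finset.subset_compl_iff_disjoint_right]
  have hD : D.card + Dᶜ.card = Fintype.card V := Finset.card_add_card_compl D
  have h1 := Finset.sum_pow_mul_eq_add_pow x (1 - x) Dᶜ
  rw [add_sub_cancel, one_pow] at h1
  rw [hs]
  refine Eq.trans ?_ ((congrArg (fun y => (1 - x) ^ D.card * y) h1).trans (mul_one _))
  rw [Finset.mul_sum]
  refine Finset.sum_congr rfl fun S hS => ?_
  have hc := Finset.card_le_card (Finset.mem_powerset.1 hS)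
  rw [weight, show Fintype.card V - S.card = D.card + (Dᶜ.card - S.card) by omega, pow_add]
  ring

theorem sum_weight (x : ℝ) : ∑ S : Finset V, weight (Fintype.card V) x S.card = 1 := by
  simpa using sum_weight_disjoint x (∅ : Finset V)

theorem sum_weight_not_disjoint (x : ℝ) (D : Finset V) :
    ∑ S : Finset V with ¬ Disjoint S D, weight (Fintype.card V) x S.card =
      1 - (1 - x) ^ D.card := by
  rw [← sum_weight_disjoint x D, ← sum_weight (V := V) x,
    ← Finset.sum_filter_add_sum_filter_not Finset.univ fun S : Finset V => Disjoint S D]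
  ring

/-- The probability that a random subset contains `v`. -/
theorem sum_weight_mem (x : ℝ) (v : V) :
    ∑ S : Finset V with v ∈ S, weight (Fintype.card V) x S.card = x := by
  simpa using sum_weight_not_disjoint x {v}

/-- The normalized number of coded bits that serve at least one user in `D`: the message for the
set `S` of users has the length of a piece cached by `S.card - 1` users. Multiplication by `x` turns
the sum into `1 - x` times the probability that a random set meets `D`; the case `x = 0` follows by
continuity. -/
theorem sum_weight_pred (x : ℝ) (D : Finset V) :
    ∑ S : Finset V with ¬ Disjoint S D, weight (Fintype.card V) x (S.card - 1) =
      (1 - x) * ∑ m ∈ Finset.range D.card, (1 - x) ^ m := by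
  suffices h : (fun x : ℝ => ∑ S : Finset V with ¬ Disjoint S D,
      weight (Fintype.card V) x (S.card - 1)) =
      fun x => (1 - x) * ∑ m ∈ Finset.range D.card, (1 - x) ^ m from congrFun h x
  refine Continuous.ext_on (dense_compl_singleton (0 : ℝ)) (by unfold weight; fun_prop)
    (by fun_prop) fun y hy => mul_left_cancel₀ (show y ≠ 0 from hy) ?_
  have hg := mul_neg_geom_sum (1 - y) D.card
  rw [sub_sub_cancel] at hg
  rw [mul_left_comm, hg, ← sum_weight_not_disjoint, Finset.mul_sum, Finset.mul_sum]
  refine Finset.sum_congr rfl fun S hS => ?_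
  have hS0 : 0 < S.card := Finset.card_pos.2 <| Finset.nonempty_iff_ne_empty.2 fun h0 =>
    (Finset.mem_filter.1 hS).2 (h0 ▸ Finset.disjoint_empty_left _)
  have hSV : S.card ≤ Fintype.card V := Finset.card_le_univ S
  obtain ⟨k, hk⟩ := Nat.exists_eq_succ_of_ne_zero hS0.ne'
  rw [hk, Nat.succ_eq_add_one, Nat.add_sub_cancel, weight, weight,
    show Fintype.card V - k = Fintype.card V - (k + 1) + 1 by omega]
  ring_nf
end

theorem r_eq_geom_sum {x : ℝ} (hx : x ∈ Set.Icc (0 : ℝ) 1) {K : ℕ} (hK : 0 < K) :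
    r x K = (1 - x) * ∑ m ∈ Finset.range K, (1 - x) ^ m := by
  have h1 : 0 ≤ 1 - x := sub_nonneg.2 hx.2
  have hK' : (K : ℝ) ≠ 0 := Nat.cast_ne_zero.2 hK.ne'
  rcases eq_or_ne x 0 with rfl | h0
  · simp [r]
  · have hg := mul_neg_geom_sum (1 - x) K
    rw [sub_sub_cancel] at hg
    have h : (K : ℝ) * (1 - x) * (1 / ((K : ℝ) * x)) * (1 - (1 - x) ^ K) =
        (1 - x) * ∑ m ∈ Finset.range K, (1 - x) ^ m := by
      rw [← hg]
      field_simp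
    rw [r, if_neg h0, h, max_eq_left]
    exact mul_nonneg h1 (Finset.sum_nonneg fun _ _ => pow_nonneg h1 _)

theorem r_nonneg {x : ℝ} (hx : x ∈ Set.Icc (0 : ℝ) 1) {K : ℕ} (hK : 0 < K) : 0 ≤ r x K := by
  have h1 : 0 ≤ 1 - x := sub_nonneg.2 hx.2
  rw [r_eq_geom_sum hx hK]
  exact mul_nonneg h1 (Finset.sum_nonneg fun _ _ => pow_nonneg h1 _)

/-- The single-layer delay for `2 * K` users splits into the part that concerns a given half of the
users, and the part that concerns only the other half. -/
theorem r_two_mul {x : ℝ} (hx : x ∈ Set.Icc (0 : ℝ) 1) {K : ℕ} (hK : 0 < K) :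
    r x (2 * K) = (1 + (1 - x) ^ K) * r x K := by
  rw [r_eq_geom_sum hx hK, r_eq_geom_sum hx (by omega), two_mul, Finset.sum_range_add]
  simp only [pow_add, ← Finset.mul_sum]
  ring

/-! ### Users, groups and placement patterns -/

/-- The user `(i, j)` is the `j`-th user of relay `i`. -/
abbrev User (K : ℕ) : Type := Fin 2 × Fin K

/-- The piece of a file with index `(A, B)` is cached exactly by the relays in `A` and by the users
in `B`. -/
abbrev Pattern (K : ℕ) : Type := Finset (Fin 2) × Finset (User K)

/-- The users that are connected to relay `i`. -/
def group {K : ℕ} (i : Fin 2) : Finset (User K) := {u | u.1 = i}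

theorem card_group {K : ℕ} (i : Fin 2) : (group i : Finset (User K)).card = K := by
  have : (group i : Finset (User K)) = {i} ×ˢ Finset.univ := by
    ext u; rw [Finset.mem_product]; simp [group]
  rw [this, Finset.card_product]; simp

theorem mem_group {K : ℕ} {i : Fin 2} {u : User K} : u ∈ group i ↔ u.1 = i := by simp [group]

/-- The set of users obtained by adding `i` to the relay index, modulo `2`: the two groups are
exchanged if `i = 1`. It lets the sets that meet group `i` be indexed by the sets that meet group
`0`, for both relays at once. -/
def shift {K : ℕ} (i : Fin 2) (S : Finset (User K)) : Finset (User K) :=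
  S.map ((Equiv.addRight i).prodCongr (Equiv.refl (Fin K))).toEmbedding

theorem shift_shift {K : ℕ} (i : Fin 2) (S : Finset (User K)) : shift i (shift i S) = S := by
  have h : ∀ a : Fin 2, a + i + i = a := by revert i; decide
  rw [shift, shift, Finset.map_map]
  refine (congrArg (fun f => S.map f) ?_).trans S.map_refl
  ext1 u
  exact Prod.ext (h u.1) rfl

theorem card_shift {K : ℕ} (i : Fin 2) (S : Finset (User K)) : (shift i S).card = S.card :=
  Finset.card_map _

theorem not_disjoint_shift {K : ℕ} {i : Fin 2} {S : Finset (User K)}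
    (h : ¬ Disjoint S (group i)) : ¬ Disjoint (shift i S) (group 0) := by
  obtain ⟨u, hu, hi⟩ := Finset.not_disjoint_iff.1 h
  rw [mem_group] at hi
  refine Finset.not_disjoint_iff.2 ⟨(u.1 + i, u.2), ?_, ?_⟩
  · exact Finset.mem_map.2 ⟨u, hu, rfl⟩
  · rw [mem_group, hi]
    exact (by decide : ∀ i : Fin 2, i + i = 0) i

/-! ### Coded messages and the delivery scheme -/

/-- The message for the set `S` of users, restricted to the group of relay `i`: the sum modulo 2,
over the users `u` of that group in `S`, of the `k`-th bits of the pieces `(A, S.erase u)` of the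
files that they request. The addition on `Bool` is `xor`. -/
def codedBit {N K : ℕ} (d : Demand N 2 K) (i : Fin 2) (A : Finset (Fin 2)) (S : Finset (User K))
    (k : ℕ) (w : Fin N → Pattern K → ℕ → Bool) : Bool :=
  ∑ u ∈ S with u.1 = i, w (d u.1 u.2) (A, S.erase u) k

section
variable {N K : ℕ} {d : Demand N 2 K} {i : Fin 2} {A : Finset (Fin 2)} {S : Finset (User K)}
  {k : ℕ} {w w' : Fin N → Pattern K → ℕ → Bool}

theorem codedBit_congr (h : ∀ n B, w n (A, B) k = w' n (A, B) k) :
    codedBit d i A S k w = codedBit d i A S k w' :=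
  Finset.sum_congr rfl fun _ _ => h _ _

/-- A user `u ∈ S` of another group has cached every summand. -/
theorem codedBit_eq_of_ne {u : User K} (hu : u ∈ S) (hi : u.1 ≠ i)
    (h : ∀ n B, u ∈ B → w n (A, B) k = w' n (A, B) k) :
    codedBit d i A S k w = codedBit d i A S k w' :=
  Finset.sum_congr rfl fun _ hv => h _ _ <|
    Finset.mem_erase.2 ⟨fun e => hi (e ▸ (Finset.mem_filter.1 hv).2), hu⟩

/-- A user `u ∈ S` of group `i` has cached every summand but its own. -/
theorem eq_of_codedBit_eq {u : User K} (hu : u ∈ S) (hi : u.1 = i)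
    (h : ∀ n B, u ∈ B → w n (A, B) k = w' n (A, B) k)
    (hc : codedBit d i A S k w = codedBit d i A S k w') :
    w (d u.1 u.2) (A, S.erase u) k = w' (d u.1 u.2) (A, S.erase u) k := by
  have hm : u ∈ S.filter fun v => v.1 = i := Finset.mem_filter.2 ⟨hu, hi⟩
  rw [codedBit, codedBit, ← Finset.add_sum_erase _ _ hm, ← Finset.add_sum_erase _ _ hm] at hc
  have hr : ∑ v ∈ (S.filter fun v => v.1 = i).erase u, w (d v.1 v.2) (A, S.erase v) k =
      ∑ v ∈ (S.filter fun v => v.1 = i).erase u, w' (d v.1 v.2) (A, S.erase v) k :=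
    Finset.sum_congr rfl fun v hv => h _ _ <|
      Finset.mem_erase.2 ⟨(Finset.mem_erase.1 hv).1.symm, hu⟩
  rw [hr] at hc
  exact add_right_cancel hc

end

theorem sum_fin_two (i : Fin 2) (g : Fin 2 → Bool) : ∑ i', g i' = g i + g (i + 1) := by
  fin_cases i
  · exact Fin.sum_univ_two g
  · exact (Fin.sum_univ_two g).trans (add_comm _ _)

/-- Messages indexed by `x ∈ s`, the one with index `x` having `ℓ x` bits. -/
abbrev Messages {X : Type*} (s : Finset X) (ℓ : X → ℕ) : Type _ := Σ x : s, Fin (ℓ x)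

theorem card_messages {X : Type*} (s : Finset X) (ℓ : X → ℕ) :
    Fintype.card (Messages s ℓ) = ∑ x ∈ s, ℓ x := by
  rw [Fintype.card_sigma, ← Finset.sum_coe_sort s ℓ]
  simp only [Fintype.card_fin]

/-- The messages indexed by a subset, as a part of all messages. -/
def Messages.inclusion {X : Type*} {s t : Finset X} (ℓ : X → ℕ) (h : s ⊆ t) :
    Messages s ℓ ↪ Messages t ℓ where
  toFun m := ⟨⟨m.1, h m.1.2⟩, m.2⟩
  inj' := by
    rintro ⟨⟨x, hx⟩, k⟩ ⟨⟨x', hx'⟩, k'⟩ h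
    cases h
    rfl

/-- The delivery scheme. The server sends, for every set `S` of users that meets group `0`, the sum
of the messages that the two relays need from each other's caches, and, for every nonempty set `S`,
the message made of the pieces that no relay has cached. A coded message for a set of `t` users,
built from pieces cached by `s` relays, has `ℓ s t` bits. The hypotheses say that the caches are
large enough and that the messages of the server and of each relay fit into `n` slots. -/
theorem exists_two_relay_scheme {N K F n : ℕ} {M₁ M₂ : ℝ} {size : Pattern K → ℕ}
    (hsize : ∑ a, size a = F)
    (hrelay : ∀ i, (N * ∑ a : Pattern K with i ∈ a.1, size a : ℝ) ≤ F * M₁)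
    (huser : ∀ u, (N * ∑ a : Pattern K with u ∈ a.2, size a : ℝ) ≤ F * M₂)
    (ℓ : ℕ → ℕ → ℕ) (hℓ : ∀ a : Pattern K, size a ≤ ℓ a.1.card (a.2.card + 1))
    (hserver : ∑ S : Finset (User K) with ¬ Disjoint S (group 0), ℓ 1 S.card +
      ∑ S : Finset (User K) with ¬ Disjoint S Finset.univ, ℓ 0 S.card ≤ n)
    (hforward : ∀ i, ∑ S : Finset (User K) with ¬ Disjoint S (group 0), ℓ 1 S.card +
      ∑ S : Finset (User K) with ¬ Disjoint S (group i), ℓ 0 S.card +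
      ∑ a : Pattern K with i ∈ a.1 ∧ ¬ Disjoint a.2 (group i), ℓ a.1.card a.2.card ≤ n) :
    ∃ S : CachingScheme N 2 K F M₁ M₂,
      (∀ d, S.slots d = n + 1) ∧ ∀ d i j W, S.output d i j W = W (d i j) := by
  classical
  obtain ⟨e⟩ : Nonempty (Fin (2 ^ F) ≃ ((Σ a, Fin (size a)) → Bool)) := by
    refine ⟨Fintype.equivOfCardEq ?_⟩
    simp [hsize]
  choose rc rd hr using fun i => exists_cache e (fun a : Pattern K => i ∈ a.1) (hrelay i)
  choose uc ud hu using fun u => exists_cache e (fun a : Pattern K => u ∈ a.2) (huser u)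
  let X := Messages {S : Finset (User K) | ¬ Disjoint S (group 0)} fun S => ℓ 1 S.card
  let Y := fun D : Finset (User K) =>
    Messages {S : Finset (User K) | ¬ Disjoint S D} fun S => ℓ 0 S.card
  let O := fun i => Messages {a : Pattern K | i ∈ a.1 ∧ ¬ Disjoint a.2 (group i)}
    fun a => ℓ a.1.card a.2.card
  have hmono : ∀ (i : Fin 2) (S : Finset (User K)),
      S ∈ ({S | ¬ Disjoint S (group i)} : Finset (Finset (User K))) →
      S ∈ ({S | ¬ Disjoint S Finset.univ} : Finset (Finset (User K))) := fun i S h =>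
    Finset.mem_filter.2 ⟨Finset.mem_univ S, fun h' => (Finset.mem_filter.1 h).2
      (h'.mono_right (Finset.subset_univ _))⟩
  let f : ∀ i, X ⊕ Y (group i) ↪ X ⊕ Y Finset.univ := fun i =>
    (Function.Embedding.refl X).sumMap (Messages.inclusion _ (hmono i))
  refine exists_scheme (Q := X ⊕ Y Finset.univ) (U := fun i => X ⊕ Y (group i)) (O := O)
    rc (fun i j => uc (i, j)) f ?_ (fun i => ?_)
    (fun d W => Sum.elim
      (fun x => ∑ i, codedBit d i {i + 1} (shift i x.1) x.2 (pieceBit e W))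
      (fun y => ∑ i, codedBit d i ∅ y.1 y.2 (pieceBit e W)))
    -- relay `i` removes the term that serves the other group, which it has in its cache
    (fun d i u z b => Sum.elim
      (fun x => b + codedBit d (i + 1) {i} (shift (i + 1) x.1) x.2 (rd i z)) (fun _ => b) u)
    (fun d i o z => codedBit d i o.1.1.1 o.1.1.2 o.2 (rd i z))
    fun d i j W W' hc hf ho => ?_
  · rw [Fintype.card_sum, card_messages, card_messages]
    exact hserver
  · rw [Fintype.card_sum, card_messages, card_messages, card_messages]
    exact hforward i
  have hcache : ∀ n a k, (i, j) ∈ a.2 → pieceBit e W n a k = pieceBit e W' n a k :=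
    fun n a k ha => by rw [← hu (i, j) W n a k ha, ← hu (i, j) W' n a k ha, hc]
  have hown : ∀ (d : Demand N 2 K) i' i A S k W, i ∈ A →
      codedBit d i' A S k (rd i (rc i W)) = codedBit d i' A S k (pieceBit e W) :=
    fun d i' i A S k W hA => codedBit_congr fun n B => hr i W n (A, B) k hA
  have hother : ∀ i : Fin 2, i + 1 + 1 = i := by decide
  have hne : ∀ i : Fin 2, i ≠ i + 1 := by decide
  have key : ∀ a k, pieceBit e W (d i j) a k = pieceBit e W' (d i j) a k := by
    rintro ⟨A, B⟩ k
    by_cases hB : (i, j) ∈ B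
    · exact hcache _ (A, B) k hB
    by_cases hk : k < size (A, B)
    swap
    · simp [pieceBit, hk]
    -- the message for `S` carries the missing piece of user `(i, j)`
    set S := insert (i, j) B
    have hmem : (i, j) ∈ S := Finset.mem_insert_self _ _
    have hcard : S.card = B.card + 1 := Finset.card_insert_of_notMem hB
    have herase : S.erase (i, j) = B := Finset.erase_insert hB
    have hmeet : ¬ Disjoint S (group i) :=
      Finset.not_disjoint_iff.2 ⟨_, hmem, mem_group.2 rfl⟩
    have hkl : k < ℓ A.card S.card := by rw [hcard]; exact hk.trans_le (hℓ (A, B))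
    suffices h : codedBit d i A S k (pieceBit e W) = codedBit d i A S k (pieceBit e W') by
      have := eq_of_codedBit_eq hmem rfl (fun n B hB => hcache n (A, B) k hB) h
      rwa [herase] at this
    -- it is computed by the relay itself, or comes from the server: on its own if no relay has
    -- cached the piece, mixed with a message for the other relay if only that relay has
    by_cases hi : i ∈ A
    · have := ho ⟨⟨(A, S), Finset.mem_filter.2 ⟨Finset.mem_univ _, hi, hmeet⟩⟩, ⟨k, hkl⟩⟩
      dsimp only at this
      rwa [hown _ _ _ _ _ _ _ hi, hown _ _ _ _ _ _ _ hi] at this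
    obtain rfl | rfl : A = ∅ ∨ A = {i + 1} := by
      revert hi; clear * -; revert i A; decide
    · have h : ∑ i', codedBit d i' ∅ S k (pieceBit e W) =
          ∑ i', codedBit d i' ∅ S k (pieceBit e W') :=
        hf (Sum.inr ⟨⟨S, Finset.mem_filter.2 ⟨Finset.mem_univ _, hmeet⟩⟩, ⟨k, hkl⟩⟩)
      rw [sum_fin_two i, sum_fin_two i,
        codedBit_eq_of_ne (w' := pieceBit e W') (i := i + 1) hmem (hne i)
          fun n B hB => hcache n (∅, B) k hB] at h
      exact add_right_cancel h
    · have hkl' : k < ℓ 1 (shift i S).card := by simpa [card_shift] using hkl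
      have h : ∑ i', codedBit d i' {i' + 1} (shift i' (shift i S)) k (pieceBit e W) +
            codedBit d (i + 1) {i} (shift (i + 1) (shift i S)) k (rd i (rc i W)) =
          ∑ i', codedBit d i' {i' + 1} (shift i' (shift i S)) k (pieceBit e W') +
            codedBit d (i + 1) {i} (shift (i + 1) (shift i S)) k (rd i (rc i W')) :=
        hf (Sum.inl ⟨⟨shift i S, Finset.mem_filter.2
          ⟨Finset.mem_univ _, not_disjoint_shift hmeet⟩⟩, ⟨k, hkl'⟩⟩)
      simpa only [sum_fin_two i, hother, shift_shift, add_assoc, BooleanRing.add_self, add_zero,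
        hown _ _ _ _ _ _ _ (Finset.mem_singleton_self i)] using h
  apply e.injective
  funext ⟨a, k⟩
  have := key a k
  simpa [pieceBit] using this

/-! ### The coding delay -/

theorem sum_le_of_le_add {Y : Type*} {ℓ : Y → ℕ} {g : Y → ℝ} {c F : ℝ}
    (h : ∀ y, (ℓ y : ℝ) ≤ F * g y + c) {m : ℕ} {s : Finset Y} (hs : s.card ≤ m) (hc : 0 ≤ c) :
    ((∑ y ∈ s, ℓ y : ℕ) : ℝ) ≤ F * ∑ y ∈ s, g y + m * c := by
  rw [Nat.cast_sum]
  refine (Finset.sum_le_sum fun y _ => h y).trans ?_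
  rw [Finset.sum_add_distrib, ← Finset.mul_sum, Finset.sum_const, nsmul_eq_mul]
  gcongr

theorem sum_pattern {K : ℕ} (P : Finset (Fin 2) → Prop) (Q : Finset (User K) → Prop)
    [DecidablePred P] [DecidablePred Q] (f : Finset (Fin 2) → ℝ) (g : Finset (User K) → ℝ) :
    ∑ a : Pattern K with P a.1 ∧ Q a.2, f a.1 * g a.2 =
      (∑ A with P A, f A) * ∑ B with Q B, g B := by
  rw [Finset.sum_mul_sum, ← Finset.sum_product', ← Finset.filter_product,
    Finset.univ_product_univ]

theorem card_finset_user_le (K : ℕ) :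
    Fintype.card (Finset (User K)) ≤ Fintype.card (Pattern K) :=
  Fintype.card_le_of_injective (fun B => (∅, B)) (Prod.mk_right_injective ∅)

/-- Every delay above both the relay delay and the server delay is achievable. All rounding errors
together take a number of slots bounded independently of `F`, hence they vanish in the normalized
delay. -/
theorem isAchievableDelay_two_relays {N K : ℕ} (hN : 0 < N) (hK : 0 < K) {M₁ M₂ T : ℝ}
    (hM₁ : M₁ ∈ Set.Icc (0 : ℝ) N) (hM₂ : M₂ ∈ Set.Icc (0 : ℝ) N)
    (hT₁ : r (M₂ / N) K < T)
    (hT₂ : M₁ / N * (1 - M₁ / N) * r (M₂ / N) K + (1 - M₁ / N) ^ 2 * r (M₂ / N) (2 * K) < T) :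
    IsAchievableDelay N 2 K M₁ M₂ T := by
  have hN' : (0 : ℝ) < N := Nat.cast_pos.2 hN
  have frac : ∀ {M : ℝ}, M ∈ Set.Icc (0 : ℝ) N → M / N ∈ Set.Icc (0 : ℝ) 1 := fun h =>
    ⟨div_nonneg h.1 hN'.le, (div_le_one hN').2 h.2⟩
  have hp := frac hM₁
  have hq := frac hM₂
  have hpM : (N : ℝ) * (M₁ / N) = M₁ := mul_div_cancel₀ _ hN'.ne'
  have hqM : (N : ℝ) * (M₂ / N) = M₂ := mul_div_cancel₀ _ hN'.ne'
  set p := M₁ / N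
  set q := M₂ / N
  set T₀ := max (r q K) (p * (1 - p) * r q K + (1 - p) ^ 2 * r q (2 * K))
  have hT₀ : 0 < T - T₀ := sub_pos.2 (max_lt hT₁ hT₂)
  have hT₀' : 0 ≤ T₀ := (r_nonneg hq hK).trans (le_max_left _ _)
  obtain ⟨m, hm⟩ : ∃ m, m = Fintype.card (Pattern K) := ⟨_, rfl⟩
  set C : ℝ := (m : ℝ)
  have hC0 : 0 ≤ C := Nat.cast_nonneg _
  intro ε hε
  filter_upwards [Filter.eventually_gt_atTop 0,
    Filter.eventually_ge_atTop ⌈(3 * (C * C) + 1) / (T - T₀)⌉₊] with F hF0 hF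
  have hF0' : (0 : ℝ) < F := Nat.cast_pos.2 hF0
  have hF' : 3 * (C * C) + 1 ≤ F * (T - T₀) := (div_le_iff₀ hT₀).1 (Nat.ceil_le.1 hF)
  have hV : Fintype.card (User K) = 2 * K := by simp
  let w : Pattern K → ℝ := fun a => weight 2 p a.1.card * weight (2 * K) q a.2.card
  have hw : ∀ a, 0 ≤ w a := fun a => mul_nonneg (weight_nonneg hp _ _) (weight_nonneg hq _ _)
  have s1 : ∑ A : Finset (Fin 2), weight 2 p A.card = 1 := sum_weight p
  have s2 : ∑ B : Finset (User K), weight (2 * K) q B.card = 1 := by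
    rw [← hV]; exact sum_weight q
  have s3 : ∀ i, ∑ A : Finset (Fin 2) with i ∈ A, weight 2 p A.card = p := sum_weight_mem p
  have s4 : ∀ u, ∑ B : Finset (User K) with u ∈ B, weight (2 * K) q B.card = q := by
    rw [← hV]; exact sum_weight_mem q
  have s5 : ∀ D : Finset (User K), 0 < D.card → ∑ S : Finset (User K) with ¬ Disjoint S D,
      weight (2 * K) q (S.card - 1) = r q D.card := fun D hD => by
    rw [← hV, sum_weight_pred, r_eq_geom_sum hq hD]
  have s6 : ∀ i, ∑ S : Finset (User K) with ¬ Disjoint S (group i),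
      weight (2 * K) q (S.card - 1) = r q K := fun i => by
    rw [s5 _ (by rwa [card_group]), card_group]
  have s7 : ∑ S : Finset (User K) with ¬ Disjoint S Finset.univ,
      weight (2 * K) q (S.card - 1) = r q (2 * K) := by
    rw [s5 _ (by rw [Finset.card_univ, hV]; omega), Finset.card_univ, hV]
  have hwsum : ∑ a, w a = 1 := by
    rw [Fintype.sum_prod_type]
    simp only [w]
    rw [← Finset.sum_mul_sum, s1, s2, one_mul]
  -- nobody caches the piece `(∅, ∅)`, so it may absorb the rounding
  obtain ⟨size, hsize, hle, hle'⟩ := exists_rounding (∅, ∅) w hw hwsum F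
  rw [← hm] at hle'
  have hcached : ∀ s : Finset (Pattern K), (∅, ∅) ∉ s →
      ((∑ a ∈ s, size a : ℕ) : ℝ) ≤ F * ∑ a ∈ s, w a := fun s hs => by
    rw [Nat.cast_sum, Finset.mul_sum]
    exact Finset.sum_le_sum fun a ha => hle a fun h => hs (h ▸ ha)
  let g : ℕ → ℕ → ℝ := fun s t => weight 2 p s * weight (2 * K) q (t - 1)
  have hg : ∀ s t, 0 ≤ F * g s t + C := fun s t =>
    add_nonneg (mul_nonneg hF0'.le (mul_nonneg (weight_nonneg hp _ _) (weight_nonneg hq _ _))) hC0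
  have hℓ : ∀ s t, (⌊F * g s t + C⌋₊ : ℝ) ≤ F * g s t + C := fun s t => Nat.floor_le (hg s t)
  have hcard : ∀ s : Finset (Finset (User K)), s.card ≤ m := fun s =>
    (Finset.card_le_univ s).trans ((card_finset_user_le K).trans hm.ge)
  -- `b1` and `b2` at `s = 0, 1` bound the server's messages, `b1` and `b3` those of a relay
  have b1 : ∀ s i, ((∑ S : Finset (User K) with ¬ Disjoint S (group i),
      ⌊F * g s S.card + C⌋₊ : ℕ) : ℝ) ≤ F * (weight 2 p s * r q K) + C * C := fun s i => by
    refine (sum_le_of_le_add (ℓ := fun S : Finset (User K) => ⌊F * g s S.card + C⌋₊)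
      (g := fun S => weight 2 p s * weight (2 * K) q (S.card - 1))
      (fun S => hℓ s S.card) (hcard _) hC0).trans (le_of_eq ?_)
    rw [← Finset.mul_sum, s6]
  have b2 : ∀ s, ((∑ S : Finset (User K) with ¬ Disjoint S Finset.univ,
      ⌊F * g s S.card + C⌋₊ : ℕ) : ℝ) ≤ F * (weight 2 p s * r q (2 * K)) + C * C := fun s => by
    refine (sum_le_of_le_add (ℓ := fun S : Finset (User K) => ⌊F * g s S.card + C⌋₊)
      (g := fun S => weight 2 p s * weight (2 * K) q (S.card - 1))
      (fun S => hℓ s S.card) (hcard _) hC0).trans (le_of_eq ?_)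
    rw [← Finset.mul_sum, s7]
  have b3 : ∀ i, ((∑ a : Pattern K with i ∈ a.1 ∧ ¬ Disjoint a.2 (group i),
      ⌊F * g a.1.card a.2.card + C⌋₊ : ℕ) : ℝ) ≤ F * (p * r q K) + C * C := fun i => by
    refine (sum_le_of_le_add (ℓ := fun a : Pattern K => ⌊F * g a.1.card a.2.card + C⌋₊)
      (g := fun a => weight 2 p a.1.card * weight (2 * K) q (a.2.card - 1))
      (fun a => hℓ a.1.card a.2.card)
      ((Finset.card_le_univ _).trans hm.ge) hC0).trans (le_of_eq ?_)
    rw [sum_pattern (fun A => i ∈ A) (fun S => ¬ Disjoint S (group i))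
      (fun A => weight 2 p A.card) (fun S => weight (2 * K) q (S.card - 1)), s3, s6]
  have w0 : weight 2 p 0 = (1 - p) ^ 2 := by simp [weight]
  have w1 : weight 2 p 1 = p * (1 - p) := by simp [weight]
  suffices h : ∃ S : CachingScheme N 2 K F M₁ M₂,
      (∀ d, S.slots d = ⌊F * T₀ + 3 * (C * C)⌋₊ + 1) ∧ ∀ d i j W, S.output d i j W = W (d i j) by
    obtain ⟨S, hS, hout⟩ := h
    refine ⟨S, ?_, fun d => ?_⟩
    · refine lt_of_le_of_lt (Finset.sup_le fun x _ => ?_) hε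
      simp [CachingScheme.errorProb, hout]
    · rw [CachingScheme.codingDelay, hS, div_le_iff₀ hF0']
      have := Nat.floor_le (show 0 ≤ F * T₀ + 3 * (C * C) by positivity)
      push_cast
      linarith
  refine exists_two_relay_scheme hsize ?_ ?_ (fun s t => ⌊F * g s t + C⌋₊) ?_ ?_ ?_
  · intro i
    have h := hcached {a | i ∈ a.1} (by simp)
    have h' := sum_pattern (K := K) (fun A => i ∈ A) (fun _ => True)
      (fun A => weight 2 p A.card) (fun S => weight (2 * K) q S.card)
    simp only [and_true, Finset.filter_true, s3, s2, mul_one] at h'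
    rw [show ∑ a : Pattern K with i ∈ a.1, w a = p from h'] at h
    refine (mul_le_mul_of_nonneg_left h hN'.le).trans (le_of_eq ?_)
    rw [mul_left_comm, hpM]
  · intro u
    have h := hcached {a | u ∈ a.2} (by simp)
    have h' := sum_pattern (K := K) (fun _ => True) (fun B => u ∈ B)
      (fun A => weight 2 p A.card) (fun S => weight (2 * K) q S.card)
    simp only [true_and, Finset.filter_true, s4, s1, one_mul] at h'
    rw [show ∑ a : Pattern K with u ∈ a.2, w a = q from h'] at h
    refine (mul_le_mul_of_nonneg_left h hN'.le).trans (le_of_eq ?_)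
    rw [mul_left_comm, hqM]
  · exact fun a => Nat.le_floor (hle' a)
  · refine Nat.le_floor ?_
    have h1 := b1 1 0
    have h2 := b2 0
    have h3 := mul_le_mul_of_nonneg_left (le_max_right (r q K)
      (p * (1 - p) * r q K + (1 - p) ^ 2 * r q (2 * K))) hF0'.le
    rw [w1] at h1
    rw [w0] at h2
    rw [Nat.cast_add]
    nlinarith [mul_nonneg hC0 hC0]
  · intro i
    refine Nat.le_floor ?_
    have h1 := b1 1 0
    have h2 := b1 0 i
    have h3 := b3 i
    have h4 := mul_le_mul_of_nonneg_left (le_max_left (r q K)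
      (p * (1 - p) * r q K + (1 - p) ^ 2 * r q (2 * K))) hF0'.le
    rw [w1] at h1
    rw [w0] at h2
    rw [Nat.cast_add, Nat.cast_add]
    refine (add_le_add (add_le_add h1 h2) h3).trans ?_
    refine le_trans (le_of_eq ?_) (add_le_add_left h4 _)
    ring

theorem optimalDelay_two_relays_le {N K : ℕ} (hN : 0 < N) (hK : 0 < K) {M₁ M₂ : ℝ}
    (hM₁ : M₁ ∈ Set.Icc (0 : ℝ) N) (hM₂ : M₂ ∈ Set.Icc (0 : ℝ) N) {T : ℝ}
    (hT₁ : r (M₂ / N) K ≤ T)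
    (hT₂ : M₁ / N * (1 - M₁ / N) * r (M₂ / N) K + (1 - M₁ / N) ^ 2 * r (M₂ / N) (2 * K) ≤ T) :
    optimalDelay N 2 K M₁ M₂ ≤ (T : EReal) := by
  refine le_of_forall_gt_imp_ge_of_dense fun c hc => ?_
  obtain ⟨x, hTx, hxc⟩ := EReal.lt_iff_exists_real_btwn.1 hc
  have hTx' : T < x := EReal.coe_lt_coe_iff.1 hTx
  refine (sInf_le ?_).trans hxc.le
  exact ⟨x, isAchievableDelay_two_relays hN hK hM₁ hM₂ (hT₁.trans_lt hTx')
    (hT₂.trans_lt hTx'), rfl⟩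

/-- The server delay minus the relay delay is the delay of the messages that are of no use to a
given relay, minus the delay of those that the relay finds in its own cache. -/
theorem server_delay_eq {x : ℝ} (hx : x ∈ Set.Icc (0 : ℝ) 1) {K : ℕ} (hK : 0 < K) (p : ℝ) :
    p * (1 - p) * r x K + (1 - p) ^ 2 * r x (2 * K) =
      r x K + ((1 - p) ^ 2 * (1 - x) ^ K - p) * r x K := by
  rw [r_two_mul hx hK]
  ring

end TwoLayerCaching

theorem corollary1 (N K₂ : ℕ) (hN : 0 < N) (hK₂ : 0 < K₂) (M₁ M₂ : ℝ)
    (hM₁ : M₁ ∈ Set.Icc (0 : ℝ) (N : ℝ)) (hM₂ : M₂ ∈ Set.Icc (0 : ℝ) (N : ℝ)) :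
    (M₁ / N ≥ (1 - M₁ / N) ^ 2 * (1 - M₂ / N) ^ K₂ →
      TwoLayerCaching.optimalDelay N 2 K₂ M₁ M₂ ≤
        ((TwoLayerCaching.r (M₂ / N) K₂ : ℝ) : EReal)) ∧
    (¬ M₁ / N ≥ (1 - M₁ / N) ^ 2 * (1 - M₂ / N) ^ K₂ →
      TwoLayerCaching.optimalDelay N 2 K₂ M₁ M₂ ≤
        ((M₁ / N * (1 - M₁ / N) * TwoLayerCaching.r (M₂ / N) K₂ +
          (1 - M₁ / N) ^ 2 * TwoLayerCaching.r (M₂ / N) (2 * K₂) : ℝ) : EReal)) := by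
  have hN' : (0 : ℝ) < N := Nat.cast_pos.2 hN
  have hq : M₂ / N ∈ Set.Icc (0 : ℝ) 1 := ⟨div_nonneg hM₂.1 hN'.le, (div_le_one hN').2 hM₂.2⟩
  have hr := TwoLayerCaching.r_nonneg hq hK₂
  have hs := TwoLayerCaching.server_delay_eq hq hK₂ (M₁ / N)
  refine ⟨fun h => TwoLayerCaching.optimalDelay_two_relays_le hN hK₂ hM₁ hM₂ le_rfl ?_,
    fun h => TwoLayerCaching.optimalDelay_two_relays_le hN hK₂ hM₁ hM₂ ?_ le_rfl⟩
  · rw [hs]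
    exact add_le_of_nonpos_right (mul_nonpos_of_nonpos_of_nonneg (sub_nonpos.2 h) hr)
  · rw [hs]
    exact le_add_of_nonneg_right (mul_nonneg (sub_nonneg.2 (not_le.1 h).le) hr)
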